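/- For every $d\in\mathbb N=\{1,2,\dots\}$ let $D_d\subset\mathbb R^d$ be an open set with Lebesgue measure $\lambda_d(D_d)=1$. Let $k\in\{0,1,2,\dots\}$ and let $L=(L_{j,d})_{0\le j\le k,\ d\in\mathbb N}$ be positive real numbers. Let $C_d^k(L)$ be the class of all $f\in C^k(D_d)$ with $|f|\le 1$ on $D_d$ and $$\|f^{(j)}(x)-f^{(j)}(y)\|\le L_{j,d}\,\|x-y\|_2\qquad\text{for all } x,y\in D_d,\ 0\le j\le k,$$ where $f^{(j)}(x)$ is the $j$-th derivative, a $j$-linear form on Euclidean $\mathbb R^d$ with norm $\|A\|=\sup_{\|\theta_i\|_2=1}|A(\theta_1,\dots,\theta_j)|$. Let $\bar C_d^k(L)\subset C_d^k(L)$ be the class of all restrictions $f|_{D_d}$ of functions $f\in C^k(\mathbb R^d)$ that satisfy the same bounds on all of $\mathbb R^d$. For a class $F_d$ of functions on $D_d$ let $n(\varepsilon,F_d)$ be the minimal number $n$ of function values such that some algorithm $A(f)=\phi(f(x_1),\dots,f(x_n))$, with an arbitrary map $\phi:\mathbb R^n\to\mathbb R$ and points $x_i\in D_d$ each of which may depend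 on $f(x_1),\dots,f(x_{i-1})$, satisfies $\sup_{f\in F_d}\left|\int_{D_d}f(x)\,dx-A(f)\right|\le\varepsilon$. Numerical integration over the classes $F_d$ is called uniformly weakly tractable if $$\lim_{d+\varepsilon^{-1}\to\infty}\frac{\ln n(\varepsilon,F_d)}{d^{\alpha}+\varepsilon^{-\alpha}}=0\qquad\text{for all }\alpha\in(0,1),$$ where $d\in\mathbb N$ and $\varepsilon\in(0,1)$ (with $\ln 0$ read as $0$). Suppose that for some real $m<\infty$ $$\limsup_{d\to\infty}\ \min_{0\le j\le k} L_{j,d}\,d^{\,m}>0,$$ that is, there is a constant $c>0$ such that, for infinitely many $d$, $L_{j,d}\ge c\,d^{-m}$ holds for all $j\in\{0,1,\dots,k\}$ simultaneously. Then numerical integration is not uniformly weakly tractable for the classes $\bar C_d^k(L)$, and hence also not for the classes $C_d^k(L)$. -/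

import Mathlib

open Filter Topology MeasureTheory
open scoped ENNReal

/-- An algorithm for functions `f : D → ℝ` that uses `n` function values, chosen adaptively.
`node i` selects the `(i + 1)`-st sample point from the first `i` computed values (only
`i < n` is ever used), and `recon` maps the `n` computed values to the output; both are
arbitrary maps. -/
structure AdaptiveAlgorithm {d : ℕ} (D : Set (EuclideanSpace ℝ (Fin d))) (n : ℕ) where
  node : (i : ℕ) → (Fin i → ℝ) → D
  recon : (Fin n → ℝ) → ℝ

namespace AdaptiveAlgorithm

variable {d n : ℕ} {D : Set (EuclideanSpace ℝ (Fin d))}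

/-- The first `i` function values `(f x₁, …, f xᵢ)` computed by the algorithm on input `f`. -/
def values (A : AdaptiveAlgorithm D n) (f : D → ℝ) : (i : ℕ) → Fin i → ℝ
  | 0 => Fin.elim0
  | i + 1 => Fin.snoc (A.values f i) (f (A.node i (A.values f i)))

/-- The output of the algorithm on input `f`. -/
def output (A : AdaptiveAlgorithm D n) (f : D → ℝ) : ℝ :=
  A.recon (A.values f n)

/-- The worst case error of the algorithm for integration over `D` on the class `F`. -/
noncomputable def error (A : AdaptiveAlgorithm D n) (F : Set (D → ℝ)) : ℝ≥0∞ :=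
  ⨆ f ∈ F, ENNReal.ofReal |(∫ x, f x ∂(volume.comap ((↑) : D → EuclideanSpace ℝ (Fin d)))) - A.output f|

end AdaptiveAlgorithm

/-- The information complexity `n(ε, F)`: the minimal number of function values needed for a
worst case error of at most `ε` (it is `⊤` if no finite number suffices). -/
noncomputable def infoComplexity {d : ℕ} {D : Set (EuclideanSpace ℝ (Fin d))}
    (ε : ℝ) (F : Set (D → ℝ)) : ℕ∞ :=
  ⨅ (n : ℕ) (_ : ∃ A : AdaptiveAlgorithm D n, A.error F ≤ ENNReal.ofReal ε), (n : ℕ∞)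

/-- The class `C_d^k(L)`: functions of class `C^k` on the (open) set `D` that are bounded by `1`
and whose `j`-th derivative is Lipschitz on `D` with constant `L j`, for all `j ≤ k`. The
derivatives are multilinear maps with the operator norm over the Euclidean space, and do not
depend on the values outside `D` of the function `f` that represents the element. -/
def smoothClass {d : ℕ} (D : Set (EuclideanSpace ℝ (Fin d))) (k : ℕ) (L : ℕ → ℝ) :
    Set (D → ℝ) :=
  {g | ∃ f : EuclideanSpace ℝ (Fin d) → ℝ, g = (fun x : D => f x) ∧
    ContDiffOn ℝ k f D ∧ (∀ x ∈ D, |f x| ≤ 1) ∧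
    ∀ j ≤ k, ∀ x ∈ D, ∀ y ∈ D,
      ‖iteratedFDerivWithin ℝ j f D x - iteratedFDerivWithin ℝ j f D y‖ ≤ L j * ‖x - y‖}

/-- The class of restrictions to `D` of the `C^k` functions on the whole of `ℝ^d` that are bounded
by `1` and whose `j`-th derivative is Lipschitz on `ℝ^d` with constant `L j`, for all `j ≤ k`. -/
def smoothClassBar {d : ℕ} (D : Set (EuclideanSpace ℝ (Fin d))) (k : ℕ) (L : ℕ → ℝ) :
    Set (D → ℝ) :=
  {g | ∃ f : EuclideanSpace ℝ (Fin d) → ℝ, g = (fun x : D => f x) ∧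
    ContDiff ℝ k f ∧ (∀ x, |f x| ≤ 1) ∧
    ∀ j ≤ k, ∀ x y,
      ‖iteratedFDeriv ℝ j f x - iteratedFDeriv ℝ j f y‖ ≤ L j * ‖x - y‖}

/-- Uniform weak tractability of a sequence of integration problems on the classes `F d`,
`d = 1, 2, …`: for every `α ∈ (0, 1)`,
`ln n(ε, F d) / (d ^ α + ε ^ (-α)) → 0` as `d + 1 / ε → ∞`, with `ε ∈ (0, 1)`.
For a problem that needs no function value at all, `ln 0` is read as `0`. -/
def UniformlyWeaklyTractable {D : (d : ℕ) → Set (EuclideanSpace ℝ (Fin d))}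
    (F : (d : ℕ) → Set (D d → ℝ)) : Prop :=
  ∀ α : ℝ, 0 < α → α < 1 →
    Tendsto
      (fun p : ℕ × ℝ =>
        ENNReal.log (max 1 (infoComplexity p.2 (F p.1) : ℝ≥0∞)) /
          (((p.1 : ℝ) ^ α + p.2 ^ (-α) : ℝ) : EReal))
      (comap (fun p : ℕ × ℝ => (p.1 : ℝ) + p.2⁻¹) atTop ⊓
        𝓟 {p : ℕ × ℝ | 1 ≤ p.1 ∧ 0 < p.2 ∧ p.2 < 1})
      (𝓝 0)

/-!
On a function vanishing at the `n` nodes an algorithm visits on input `0`, the algorithm returns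
the same output as on `0`. If `0 ≤ u ≤ 1` is smooth, equal to `1` at these nodes and `0` off the
cubes of side `1 / 4` centred at them, then `a (1 - u)` and `-a (1 - u)` are such functions, and
the cubes have total volume only `n / 4 ^ d`. So the error is at least `a (λ(D) - n / 4 ^ d)` as
soon as `± a (1 - u)` belong to the class.

To obtain `u`, the indicator function of smaller cubes is convolved `k + 1` times with a product
kernel `φ`. Each derivative falls on its own factor `φ`, so a derivative of order `j ≤ k + 1` is
bounded by `(∫ ‖∇φ‖) ^ j`, which is polynomial in `d`: by the product structure `∫ ‖∇φ‖ ≤ C d`.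
Hence `a` may be chosen as `c d ^ (-s)`, and an error of that order requires at least `2 ^ d`
function values for infinitely many `d`, whereas `d ^ α + ε ^ (-α) = O(d)` for `ε` of order
`d ^ (-s)` and `α ≤ 1 / (s + 1)`.
-/

section Convolution

open scoped ContDiff Convolution

theorem norm_convolution_le {𝕜 G E E' F : Type*} [NontriviallyNormedField 𝕜] [AddGroup G]
    [MeasurableSpace G] {μ : Measure G}
    [NormedAddCommGroup E] [NormedSpace 𝕜 E] [NormedAddCommGroup E'] [NormedSpace 𝕜 E']
    [NormedAddCommGroup F] [NormedSpace 𝕜 F] [NormedSpace ℝ F]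
    (L : E →L[𝕜] E' →L[𝕜] F) {f : G → E} (hf : Integrable f μ) {g : G → E'} {B : ℝ}
    (hg : ∀ x, ‖g x‖ ≤ B) (x : G) :
    ‖(f ⋆[L, μ] g) x‖ ≤ ‖L‖ * (∫ t, ‖f t‖ ∂μ) * B := by
  rw [convolution_def, ← integral_const_mul, ← integral_mul_const]
  refine norm_integral_le_of_norm_le ((hf.norm.const_mul _).mul_const _) (ae_of_all _ fun t => ?_)
  exact (L.le_opNorm₂ _ _).trans (by gcongr; exact hg _)

variable {E G : Type*} [NormedAddCommGroup E] [MeasurableSpace E]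
  [NormedAddCommGroup G] [NormedSpace ℝ G] {μ : Measure E} {φ : E → ℝ} {g : E → G} {B : ℝ}

/-- Smoothing by convolution with a scalar kernel `φ`. The function to be smoothed is the last
argument, so that `(mollify φ μ)^[j]` smooths `j` times. -/
noncomputable def mollify (φ : E → ℝ) (μ : Measure E) (g : E → G) : E → G :=
  φ ⋆[ContinuousLinearMap.lsmul ℝ ℝ, μ] g

theorem norm_mollify_le (hφ : Integrable φ μ) (hg : ∀ x, ‖g x‖ ≤ B) (x : E) :
    ‖mollify φ μ g x‖ ≤ (∫ t, ‖φ t‖ ∂μ) * B := by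
  refine (norm_convolution_le _ hφ hg x).trans ?_
  have hB : 0 ≤ B := (norm_nonneg _).trans (hg x)
  gcongr
  exact mul_le_of_le_one_left (by positivity) ContinuousLinearMap.opNorm_lsmul_le

theorem iterate_mollify_nonneg (hφ : ∀ x, 0 ≤ φ x) {g : E → ℝ} (hg : ∀ x, 0 ≤ g x) (j : ℕ)
    (x : E) : 0 ≤ (mollify φ μ)^[j] g x := by
  induction j generalizing g with
  | zero => exact hg x
  | succ _ ih => exact ih fun z => integral_nonneg fun t => mul_nonneg (hφ t) (hg (z - t))

variable [NormedSpace ℝ E]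

theorem iterate_mollify_eq_of_eqOn_closedBall (p : Seminorm ℝ E) {r : ℝ}
    (hsupp : ∀ t, φ t ≠ 0 → p t ≤ r) (hφ : ∫ t, φ t ∂μ = 1) {g : E → ℝ} {c : ℝ} {x : E} (j : ℕ)
    (hg : ∀ y ∈ p.closedBall x (j * r), g y = c) : (mollify φ μ)^[j] g x = c := by
  induction j generalizing g with
  | zero => exact hg x (by simp)
  | succ j ih =>
    refine ih fun z hz => ?_
    have integrand_eq (t : E) : φ t • g (z - t) = φ t * c := by
      by_cases ht : φ t = 0
      · simp only [ht, zero_smul, zero_mul]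
      · have hzt : z - t ∈ p.closedBall x ((j + 1 : ℕ) * r) := by
          rw [p.mem_closedBall] at hz ⊢
          calc p (z - t - x) = p (z - x - t) := by rw [sub_right_comm]
            _ ≤ p (z - x) + p t := map_sub_le_add p _ _
            _ ≤ j * r + r := add_le_add hz (hsupp t ht)
            _ = (j + 1 : ℕ) * r := by push_cast; ring
        rw [hg _ hzt, smul_eq_mul]
    calc mollify φ μ g z = ∫ t, φ t * c ∂μ := integral_congr_ae (ae_of_all _ integrand_eq)
      _ = c := by rw [integral_mul_const, hφ, one_mul]

section Derivatives

variable [BorelSpace E] [FiniteDimensional ℝ E] [μ.IsAddHaarMeasure]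

theorem norm_fderiv_mollify_le (hφ : ContDiff ℝ 1 φ) (hφs : HasCompactSupport φ)
    (hg : LocallyIntegrable g μ) (hB : ∀ x, ‖g x‖ ≤ B) (x : E) :
    ‖fderiv ℝ (mollify φ μ g) x‖ ≤ (∫ t, ‖fderiv ℝ φ t‖ ∂μ) * B := by
  have hint : Integrable (fderiv ℝ φ) μ :=
    (hφ.continuous_fderiv one_ne_zero).integrable_of_hasCompactSupport (hφs.fderiv ℝ)
  rw [mollify, (hφs.hasFDerivAt_convolution_left _ hφ hg x).fderiv]
  refine (norm_convolution_le _ hint hB x).trans ?_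
  have hB0 : 0 ≤ B := (norm_nonneg _).trans (hB x)
  gcongr
  exact mul_le_of_le_one_left (by positivity)
    ((ContinuousLinearMap.norm_precompL_le _ _).trans ContinuousLinearMap.opNorm_lsmul_le)

theorem fderiv_mollify (hφ : LocallyIntegrable φ μ) (hg : ContDiff ℝ 1 g)
    (hgs : HasCompactSupport g) : fderiv ℝ (mollify φ μ g) = mollify φ μ (fderiv ℝ g) :=
  funext fun x => (hgs.hasFDerivAt_convolution_right _ hφ hg x).fderiv

end Derivatives

/-- A nonnegative smooth compactly supported kernel of total mass one, for smoothing without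
increasing sup norms. -/
structure IsMollifier (φ : E → ℝ) (μ : Measure E) : Prop where
  nonneg : ∀ x, 0 ≤ φ x
  contDiff : ContDiff ℝ ∞ φ
  hasCompactSupport : HasCompactSupport φ
  integral_eq_one : ∫ x, φ x ∂μ = 1

namespace IsMollifier

theorem hasCompactSupport_mollify (hφ : IsMollifier φ μ) (hg : HasCompactSupport g) :
    HasCompactSupport (mollify φ μ g) :=
  hφ.hasCompactSupport.convolution _ hg

variable [BorelSpace E]

theorem integrable [IsFiniteMeasureOnCompacts μ] (hφ : IsMollifier φ μ) : Integrable φ μ :=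
  hφ.contDiff.continuous.integrable_of_hasCompactSupport hφ.hasCompactSupport

theorem norm_iterate_mollify_le [IsFiniteMeasureOnCompacts μ] (hφ : IsMollifier φ μ)
    (hg : ∀ x, ‖g x‖ ≤ B) (j : ℕ) (x : E) : ‖(mollify φ μ)^[j] g x‖ ≤ B := by
  induction j generalizing g with
  | zero => exact hg x
  | succ _ ih =>
    refine ih fun y => (norm_mollify_le hφ.integrable hg y).trans_eq ?_
    simp only [Real.norm_of_nonneg (hφ.nonneg _), hφ.integral_eq_one, one_mul]

variable [FiniteDimensional ℝ E] [μ.IsAddHaarMeasure]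

theorem contDiff_mollify (hφ : IsMollifier φ μ) (hg : LocallyIntegrable g μ) :
    ContDiff ℝ ∞ (mollify φ μ g) :=
  hφ.hasCompactSupport.contDiff_convolution_left _ hφ.contDiff hg

theorem contDiff_iterate_succ_mollify (hφ : IsMollifier φ μ) (hg : LocallyIntegrable g μ) (j : ℕ) :
    ContDiff ℝ ∞ ((mollify φ μ)^[j + 1] g) := by
  induction j with
  | zero => exact hφ.contDiff_mollify hg
  | succ j ih =>
    rw [Function.iterate_succ_apply']
    exact hφ.contDiff_mollify ih.continuous.locallyIntegrable

theorem fderiv_iterate_mollify (hφ : IsMollifier φ μ) (hg : ContDiff ℝ ∞ g)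
    (hgs : HasCompactSupport g) (j : ℕ) :
    fderiv ℝ ((mollify φ μ)^[j] g) = (mollify φ μ)^[j] (fderiv ℝ g) := by
  induction j generalizing g with
  | zero => rfl
  | succ j ih =>
    rw [Function.iterate_succ_apply, Function.iterate_succ_apply,
      ih (hφ.contDiff_mollify hg.continuous.locallyIntegrable) (hφ.hasCompactSupport_mollify hgs),
      fderiv_mollify hφ.integrable.locallyIntegrable (hg.of_le (by simp)) hgs]

end IsMollifier

universe u

/- `E` and `G` share a universe because the induction passes from `G` to `E →L[ℝ] G`; each of the
`i` derivatives is absorbed by its own convolution. -/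
theorem IsMollifier.norm_iteratedFDeriv_iterate_mollify_le {E G : Type u} [NormedAddCommGroup E]
    [NormedSpace ℝ E] [FiniteDimensional ℝ E] [MeasurableSpace E] [BorelSpace E]
    [NormedAddCommGroup G] [NormedSpace ℝ G] {μ : Measure E} [μ.IsAddHaarMeasure] {φ : E → ℝ}
    (hφ : IsMollifier φ μ) {g : E → G} (hg : LocallyIntegrable g μ) (hgs : HasCompactSupport g)
    {B : ℝ} (hB : ∀ x, ‖g x‖ ≤ B) {i j : ℕ} (hij : i ≤ j) (x : E) :
    ‖iteratedFDeriv ℝ i ((mollify φ μ)^[j] g) x‖ ≤ (∫ t, ‖fderiv ℝ φ t‖ ∂μ) ^ i * B := by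
  induction i generalizing G B j with
  | zero =>
    rw [norm_iteratedFDeriv_zero, pow_zero, one_mul]
    exact hφ.norm_iterate_mollify_le hB j x
  | succ i ih =>
    obtain ⟨l, rfl⟩ := Nat.exists_eq_add_of_le' (Nat.succ_pos i |>.trans_le hij)
    have hsmooth := hφ.contDiff_mollify hg
    have hsupp := hφ.hasCompactSupport_mollify hgs
    rw [← norm_iteratedFDeriv_fderiv, Function.iterate_succ_apply,
      hφ.fderiv_iterate_mollify hsmooth hsupp, pow_succ, mul_assoc]
    exact ih (hsmooth.continuous_fderiv (by simp)).locallyIntegrable (hsupp.fderiv ℝ)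
      (norm_fderiv_mollify_le (hφ.contDiff.of_le (by simp)) hφ.hasCompactSupport hg hB)
      (Nat.le_of_succ_le_succ hij)

end Convolution

section ProductKernel

open scoped ContDiff

variable {ι : Type*}

section SupSeminorm

variable (ι) [Fintype ι]

/-- The supremum norm of the coordinates, as a seminorm on Euclidean space. Its closed balls are
the axis-parallel cubes. -/
noncomputable def supSeminorm : Seminorm ℝ (EuclideanSpace ℝ ι) :=
  (normSeminorm ℝ (ι → ℝ)).comp (WithLp.linearEquiv 2 ℝ (ι → ℝ)).toLinearMap

variable {ι}

theorem supSeminorm_le_iff {r : ℝ} (hr : 0 ≤ r) {x : EuclideanSpace ℝ ι} :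
    supSeminorm ι x ≤ r ↔ ∀ i, |x i| ≤ r :=
  pi_norm_le_iff_of_nonneg hr

theorem supSeminorm_closedBall_eq_preimage (x : EuclideanSpace ℝ ι) (r : ℝ) :
    (supSeminorm ι).closedBall x r = WithLp.ofLp ⁻¹' Metric.closedBall x.ofLp r := by
  ext y
  rw [Seminorm.mem_closedBall, Set.mem_preimage, mem_closedBall_iff_norm]
  rfl

theorem isCompact_supSeminorm_closedBall (x : EuclideanSpace ℝ ι) (r : ℝ) :
    IsCompact ((supSeminorm ι).closedBall x r) := by
  rw [supSeminorm_closedBall_eq_preimage]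
  exact (PiLp.homeomorph 2 fun _ : ι => ℝ).isCompact_preimage.2 (isCompact_closedBall _ _)

theorem volume_supSeminorm_closedBall (x : EuclideanSpace ℝ ι) {r : ℝ} (hr : 0 ≤ r) :
    volume ((supSeminorm ι).closedBall x r) = ENNReal.ofReal ((2 * r) ^ Fintype.card ι) := by
  rw [supSeminorm_closedBall_eq_preimage, (PiLp.volume_preserving_ofLp ι).measure_preimage
    measurableSet_closedBall.nullMeasurableSet, Real.volume_pi_closedBall _ hr]

end SupSeminorm

variable [Fintype ι]

/-- The function on Euclidean space with the factor `f i` in the `i`-th coordinate, from which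
mollifiers are built out of one-dimensional ones. -/
noncomputable def coordProd (f : ι → ℝ → ℝ) (x : EuclideanSpace ℝ ι) : ℝ :=
  ∏ i, f i (x i)

theorem contDiff_coordProd {n : WithTop ℕ∞} {f : ι → ℝ → ℝ} (hf : ∀ i, ContDiff ℝ n (f i)) :
    ContDiff ℝ n (coordProd f) :=
  contDiff_prod fun i _ => (hf i).comp (EuclideanSpace.proj (𝕜 := ℝ) i).contDiff

theorem integral_coordProd (f : ι → ℝ → ℝ) : ∫ x, coordProd f x = ∏ i, ∫ t, f i t := by
  rw [← integral_fintype_prod_volume_eq_prod]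
  exact (PiLp.volume_preserving_ofLp ι).integral_comp
    (MeasurableEquiv.toLp 2 (ι → ℝ)).symm.measurableEmbedding fun y => ∏ i, f i (y i)

theorem integrable_coordProd {f : ι → ℝ → ℝ} (hf : ∀ i, Integrable (f i)) :
    Integrable (coordProd f) :=
  (PiLp.volume_preserving_ofLp ι).integrable_comp_of_integrable (Integrable.fintype_prod hf)

theorem norm_coordProd (f : ι → ℝ → ℝ) (x : EuclideanSpace ℝ ι) :
    ‖coordProd f x‖ = coordProd (fun i t => ‖f i t‖) x :=
  norm_prod _ _

theorem coordProd_update [DecidableEq ι] (f : ι → ℝ → ℝ) (i : ι) (g : ℝ → ℝ)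
    (x : EuclideanSpace ℝ ι) :
    coordProd (Function.update f i g) x = (∏ l ∈ Finset.univ.erase i, f l (x l)) * g (x i) := by
  rw [coordProd, ← Finset.prod_erase_mul _ _ (Finset.mem_univ i), Function.update_self]
  congr 1
  exact Finset.prod_congr rfl fun l hl => by rw [Function.update_of_ne (Finset.ne_of_mem_erase hl)]

theorem norm_fderiv_coordProd_le [DecidableEq ι] {f : ι → ℝ → ℝ}
    (hf : ∀ i, Differentiable ℝ (f i)) (x : EuclideanSpace ℝ ι) :
    ‖fderiv ℝ (coordProd f) x‖ ≤ ∑ i, ‖coordProd (Function.update f i (deriv (f i))) x‖ := by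
  have hasFDerivAt_factor (i : ι) : HasFDerivAt (fun y : EuclideanSpace ℝ ι => f i (y i))
      (deriv (f i) (x i) • EuclideanSpace.proj i) x :=
    (hf i (x i)).hasDerivAt.comp_hasFDerivAt x (EuclideanSpace.proj (𝕜 := ℝ) i).hasFDerivAt
  have norm_proj_le (i : ι) : ‖(EuclideanSpace.proj i : EuclideanSpace ℝ ι →L[ℝ] ℝ)‖ ≤ 1 :=
    ContinuousLinearMap.opNorm_le_bound _ zero_le_one fun v => by
      rw [one_mul]; exact PiLp.norm_apply_le v i
  have hderiv : fderiv ℝ (coordProd f) x = _ :=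
    (HasFDerivAt.finsetProd fun i _ => hasFDerivAt_factor i).fderiv
  rw [hderiv]
  refine (norm_sum_le _ _).trans (Finset.sum_le_sum fun i _ => ?_)
  rw [smul_smul, norm_smul, coordProd_update]
  exact mul_le_of_le_one_right (norm_nonneg _) (norm_proj_le i)

theorem integral_norm_fderiv_coordProd_le [DecidableEq ι] {f : ι → ℝ → ℝ}
    (hf : ∀ i, Differentiable ℝ (f i)) (hfi : ∀ i, Integrable (f i))
    (hfi' : ∀ i, Integrable (deriv (f i))) :
    ∫ x, ‖fderiv ℝ (coordProd f) x‖ ≤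
      ∑ i, (∏ l ∈ Finset.univ.erase i, ∫ t, ‖f l t‖) * ∫ t, ‖deriv (f i) t‖ := by
  have hint (i : ι) : Integrable (coordProd (Function.update f i (deriv (f i)))) :=
    integrable_coordProd fun l => by
      rcases eq_or_ne l i with rfl | hl
      · rw [Function.update_self]; exact hfi' l
      · rw [Function.update_of_ne hl]; exact hfi l
  calc ∫ x, ‖fderiv ℝ (coordProd f) x‖
      ≤ ∫ x, ∑ i, ‖coordProd (Function.update f i (deriv (f i))) x‖ :=
        integral_mono_of_nonneg (ae_of_all _ fun _ => norm_nonneg _)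
          (integrable_finsetSum _ fun i _ => (hint i).norm)
          (ae_of_all _ (norm_fderiv_coordProd_le hf))
    _ = ∑ i, ∫ x, ‖coordProd (Function.update f i (deriv (f i))) x‖ :=
        integral_finsetSum _ fun i _ => (hint i).norm
    _ = _ := Finset.sum_congr rfl fun i _ => by
        simp only [norm_coordProd]
        rw [integral_coordProd, ← Finset.prod_erase_mul _ _ (Finset.mem_univ i),
          Function.update_self]
        congr 1
        exact Finset.prod_congr rfl fun l hl => by
          rw [Function.update_of_ne (Finset.ne_of_mem_erase hl)]

theorem isMollifier_coordProd {f : ι → ℝ → ℝ} (hf : ∀ i, IsMollifier (f i) volume) :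
    IsMollifier (coordProd f) volume where
  nonneg x := Finset.prod_nonneg fun i _ => (hf i).nonneg _
  contDiff := contDiff_coordProd fun i => (hf i).contDiff
  hasCompactSupport := by
    refine HasCompactSupport.intro ((PiLp.homeomorph 2 fun _ : ι => ℝ).isCompact_preimage.2
      (isCompact_univ_pi fun i => (hf i).hasCompactSupport)) fun x hx => ?_
    obtain ⟨i, hi⟩ : ∃ i, x i ∉ tsupport (f i) := by
      by_contra! h
      exact hx fun i _ => h i
    exact Finset.prod_eq_zero (Finset.mem_univ i) (image_eq_zero_of_notMem_tsupport hi)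
  integral_eq_one := by
    rw [integral_coordProd, Finset.prod_eq_one fun i _ => (hf i).integral_eq_one]

theorem isMollifier_contDiffBump_normed {E : Type*} [NormedAddCommGroup E] [NormedSpace ℝ E]
    [HasContDiffBump E] [MeasurableSpace E] [BorelSpace E] [FiniteDimensional ℝ E] {μ : Measure E}
    [IsLocallyFiniteMeasure μ] [μ.IsOpenPosMeasure] {c : E} (b : ContDiffBump c) :
    IsMollifier (b.normed μ) μ where
  nonneg := b.nonneg_normed
  contDiff := b.contDiff_normed
  hasCompactSupport := b.hasCompactSupport_normed
  integral_eq_one := b.integral_normed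

theorem exists_isMollifier_integral_norm_fderiv_le {r : ℝ} (hr : 0 < r) :
    ∃ C : ℝ, 1 ≤ C ∧ ∀ (ι : Type*) [Fintype ι], ∃ φ : EuclideanSpace ℝ ι → ℝ,
      IsMollifier φ volume ∧ (∀ t, φ t ≠ 0 → supSeminorm ι t ≤ r) ∧
        ∫ t, ‖fderiv ℝ φ t‖ ≤ C * Fintype.card ι := by
  classical
  let b : ContDiffBump (0 : ℝ) := ⟨r / 2, r, half_pos hr, half_lt_self hr⟩
  set η : ℝ → ℝ := b.normed volume
  have hη : IsMollifier η volume := isMollifier_contDiffBump_normed b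
  have abs_le_of_ne_zero (t : ℝ) (ht : η t ≠ 0) : |t| ≤ r := by
    have ht' : t ∈ Metric.ball 0 r := b.support_normed_eq (μ := volume) ▸ ht
    exact (mem_ball_zero_iff.1 ht').le
  have integral_norm_eq_one : ∫ t, ‖η t‖ = 1 := by
    simp only [Real.norm_of_nonneg (hη.nonneg _), hη.integral_eq_one]
  have hη' : Integrable (deriv η) :=
    (hη.contDiff.continuous_deriv (by simp)).integrable_of_hasCompactSupport
      hη.hasCompactSupport.deriv
  refine ⟨max 1 (∫ t, ‖deriv η t‖), le_max_left _ _, fun ι _ => ⟨coordProd fun _ => η,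
    isMollifier_coordProd fun _ => hη, fun t ht => ?_, ?_⟩⟩
  · exact (supSeminorm_le_iff hr.le).2 fun i =>
      abs_le_of_ne_zero _ (Finset.prod_ne_zero_iff.1 ht i (Finset.mem_univ i))
  · calc ∫ t, ‖fderiv ℝ (coordProd fun _ : ι => η) t‖
        ≤ ∑ i, (∏ l ∈ Finset.univ.erase i, ∫ t, ‖η t‖) * ∫ t, ‖deriv η t‖ :=
          integral_norm_fderiv_coordProd_le (fun _ => hη.contDiff.differentiable (by simp))
            (fun _ => hη.integrable) fun _ => hη'
      _ = (∫ t, ‖deriv η t‖) * Fintype.card ι := by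
          simp only [integral_norm_eq_one, Finset.prod_const_one, one_mul, Finset.sum_const,
            Finset.card_univ, nsmul_eq_mul, mul_comm]
      _ ≤ max 1 (∫ t, ‖deriv η t‖) * Fintype.card ι := by
          gcongr
          exact le_max_right _ _

end ProductKernel

section SmoothIndicator

open scoped ContDiff

theorem norm_indicator_one_le_one {α : Type*} (K : Set α) (x : α) :
    ‖K.indicator (1 : α → ℝ) x‖ ≤ 1 :=
  (norm_indicator_le_norm_self _ _).trans_eq norm_one

theorem disjoint_seminorm_closedBall_of_add_lt {E : Type*} [AddCommGroup E] [Module ℝ E]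
    {p : Seminorm ℝ E} {r s : ℝ} {x y : E} (h : r + s < p (x - y)) :
    Disjoint (p.closedBall x r) (p.closedBall y s) := by
  refine Set.disjoint_left.2 fun z hzx hzy => h.not_ge ?_
  rw [p.mem_closedBall] at hzx hzy
  calc p (x - y) = p (z - y - (z - x)) := by rw [sub_sub_sub_cancel_left]
    _ ≤ p (z - y) + p (z - x) := map_sub_le_add p _ _
    _ ≤ r + s := by rw [add_comm r]; exact add_le_add hzy hzx

variable {E : Type*} [NormedAddCommGroup E] [MeasurableSpace E]

/-- The indicator function of `K`, smoothed `N` times by convolution with `φ`. This is a bump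
function whose first `N` derivatives are controlled by `∫ ‖fderiv ℝ φ‖`. -/
noncomputable def smoothIndicator (φ : E → ℝ) (μ : Measure E) (N : ℕ) (K : Set E) : E → ℝ :=
  (mollify φ μ)^[N] (K.indicator 1)

theorem locallyIntegrable_indicator_one [BorelSpace E] {μ : Measure E}
    [IsFiniteMeasureOnCompacts μ] {K : Set E} (hK : IsCompact K) :
    LocallyIntegrable (K.indicator (1 : E → ℝ)) μ :=
  ((integrable_indicator_iff hK.measurableSet).2
    (integrableOn_const hK.measure_lt_top.ne)).locallyIntegrable

variable [NormedSpace ℝ E] {φ : E → ℝ} {μ : Measure E} {K : Set E} {p : Seminorm ℝ E} {r : ℝ}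
  {N : ℕ} {x : E}

theorem smoothIndicator_eq_one (hsupp : ∀ t, φ t ≠ 0 → p t ≤ r) (hφ : ∫ t, φ t ∂μ = 1)
    (hx : p.closedBall x (N * r) ⊆ K) : smoothIndicator φ μ N K x = 1 :=
  iterate_mollify_eq_of_eqOn_closedBall p hsupp hφ N fun _ hy => Set.indicator_of_mem (hx hy) _

theorem smoothIndicator_eq_zero (hsupp : ∀ t, φ t ≠ 0 → p t ≤ r) (hφ : ∫ t, φ t ∂μ = 1)
    (hx : Disjoint (p.closedBall x (N * r)) K) : smoothIndicator φ μ N K x = 0 :=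
  iterate_mollify_eq_of_eqOn_closedBall p hsupp hφ N fun _ hy =>
    Set.indicator_of_notMem (Set.disjoint_left.1 hx hy) _

namespace IsMollifier

variable [BorelSpace E]

theorem smoothIndicator_mem_Icc [IsFiniteMeasureOnCompacts μ] (hφ : IsMollifier φ μ) (N : ℕ)
    (K : Set E) (x : E) : smoothIndicator φ μ N K x ∈ Set.Icc 0 1 :=
  ⟨iterate_mollify_nonneg hφ.nonneg (Set.indicator_nonneg fun _ _ => zero_le_one) N x,
    (Real.le_norm_self _).trans (hφ.norm_iterate_mollify_le (norm_indicator_one_le_one K) N x)⟩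

theorem contDiff_smoothIndicator_succ [FiniteDimensional ℝ E] [μ.IsAddHaarMeasure]
    (hφ : IsMollifier φ μ) (hK : IsCompact K) (N : ℕ) :
    ContDiff ℝ ∞ (smoothIndicator φ μ (N + 1) K) :=
  hφ.contDiff_iterate_succ_mollify (locallyIntegrable_indicator_one hK) N

theorem norm_iteratedFDeriv_smoothIndicator_le {E : Type} [NormedAddCommGroup E]
    [NormedSpace ℝ E] [FiniteDimensional ℝ E] [MeasurableSpace E] [BorelSpace E] {μ : Measure E}
    [μ.IsAddHaarMeasure] {φ : E → ℝ} (hφ : IsMollifier φ μ) {K : Set E} (hK : IsCompact K)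
    {i N : ℕ} (hi : i ≤ N) (x : E) :
    ‖iteratedFDeriv ℝ i (smoothIndicator φ μ N K) x‖ ≤ (∫ t, ‖fderiv ℝ φ t‖ ∂μ) ^ i := by
  have hsupp : HasCompactSupport (K.indicator (1 : E → ℝ)) :=
    HasCompactSupport.intro hK fun y hy => Set.indicator_of_notMem hy _
  exact (hφ.norm_iteratedFDeriv_iterate_mollify_le (locallyIntegrable_indicator_one hK) hsupp
    (norm_indicator_one_le_one K) hi x).trans_eq (mul_one _)

end IsMollifier

theorem exists_contDiff_eq_one_eq_zero_off_iUnion_closedBall (k : ℕ) {r : ℝ} (hr : 0 < r) :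
    ∃ C : ℝ, 1 ≤ C ∧ ∀ {ι : Type} {κ : Type*} [Fintype ι] [Finite κ]
      (x : κ → EuclideanSpace ℝ ι), ∃ u : EuclideanSpace ℝ ι → ℝ, ContDiff ℝ ∞ u ∧
        (∀ y, u y ∈ Set.Icc 0 1) ∧ (∀ i, u (x i) = 1) ∧
        (∀ y ∉ ⋃ i, (supSeminorm ι).closedBall (x i) r, u y = 0) ∧
        ∀ j ≤ k + 1, ∀ y, ‖iteratedFDeriv ℝ j u y‖ ≤ (C * Fintype.card ι) ^ j := by
  set h : ℝ := r / 2 / (k + 1 : ℕ) with h_def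
  obtain ⟨C, hC, exists_kernel⟩ :=
    exists_isMollifier_integral_norm_fderiv_le (r := h) (by positivity)
  refine ⟨C, hC, fun {ι κ} _ _ x => ?_⟩
  obtain ⟨φ, hφ, hφ_supp, hφ_fderiv⟩ := exists_kernel ι
  have smoothing_radius : (k + 1 : ℕ) * h = r / 2 := by rw [h_def]; field_simp
  set K : Set (EuclideanSpace ℝ ι) := ⋃ i, (supSeminorm ι).closedBall (x i) (r / 2) with K_def
  have hK : IsCompact K := isCompact_iUnion fun i => isCompact_supSeminorm_closedBall _ _
  refine ⟨smoothIndicator φ volume (k + 1) K, hφ.contDiff_smoothIndicator_succ hK k,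
    hφ.smoothIndicator_mem_Icc _ K, fun i => ?_, fun y hy => ?_, fun j hj y => ?_⟩
  · refine smoothIndicator_eq_one hφ_supp hφ.integral_eq_one ?_
    rw [smoothing_radius]
    exact Set.subset_iUnion_of_subset i subset_rfl
  · refine smoothIndicator_eq_zero hφ_supp hφ.integral_eq_one ?_
    rw [smoothing_radius, K_def, Set.disjoint_iUnion_right]
    refine fun i => disjoint_seminorm_closedBall_of_add_lt ?_
    rw [add_halves]
    exact lt_of_not_ge fun hi => hy (Set.mem_iUnion_of_mem i (Seminorm.mem_closedBall _ |>.2 hi))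
  · refine (hφ.norm_iteratedFDeriv_smoothIndicator_le hK hj y).trans ?_
    gcongr

end SmoothIndicator

namespace AdaptiveAlgorithm

variable {d n : ℕ} {D : Set (EuclideanSpace ℝ (Fin d))}

theorem values_eq_of_eq_at_nodes (A : AdaptiveAlgorithm D n) {f g : D → ℝ}
    (h : ∀ i < n, f (A.node i (A.values g i)) = g (A.node i (A.values g i))) :
    ∀ i ≤ n, A.values f i = A.values g i
  | 0, _ => rfl
  | i + 1, hi => by
    rw [values, values, A.values_eq_of_eq_at_nodes h i (Nat.le_of_succ_le hi), h i hi]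

theorem abs_integral_sub_output_le (A : AdaptiveAlgorithm D n) {F : Set (D → ℝ)} {ε : ℝ}
    (hε : 0 ≤ ε) (hA : A.error F ≤ ENNReal.ofReal ε) {f : D → ℝ} (hf : f ∈ F) :
    |(∫ x, f x ∂(volume.comap ((↑) : D → EuclideanSpace ℝ (Fin d)))) - A.output f| ≤ ε :=
  (ENNReal.ofReal_le_ofReal_iff hε).1 (iSup₂_le_iff.1 hA f hf)

theorem integral_le_of_forall_node_eq_zero (A : AdaptiveAlgorithm D n) {F : Set (D → ℝ)} {ε : ℝ}
    (hε : 0 ≤ ε) (hA : A.error F ≤ ENNReal.ofReal ε) {f : D → ℝ} (hf : f ∈ F) (hf' : -f ∈ F)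
    (hf0 : ∀ i < n, f (A.node i (A.values 0 i)) = 0) :
    ∫ x, f x ∂(volume.comap ((↑) : D → EuclideanSpace ℝ (Fin d))) ≤ ε := by
  have output_eq {g : D → ℝ} (hg : ∀ i < n, g (A.node i (A.values 0 i)) = 0) :
      A.output g = A.output 0 := by
    rw [output, output, A.values_eq_of_eq_at_nodes hg n le_rfl]
  have error_f := A.abs_integral_sub_output_le hε hA hf
  have error_neg_f := A.abs_integral_sub_output_le hε hA hf'
  rw [output_eq hf0] at error_f
  rw [output_eq fun i hi => neg_eq_zero.2 (hf0 i hi)] at error_neg_f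
  simp only [Pi.neg_apply, integral_neg] at error_neg_f
  linarith [(abs_le.1 error_f).2, (abs_le.1 error_neg_f).1]

end AdaptiveAlgorithm

section SmoothClass

variable {d k : ℕ} {D : Set (EuclideanSpace ℝ (Fin d))} {L : ℕ → ℝ}
  {f u : EuclideanSpace ℝ (Fin d) → ℝ}

theorem smoothClassBar_subset_smoothClass (hD : UniqueDiffOn ℝ D) (k : ℕ) (L : ℕ → ℝ) :
    smoothClassBar D k L ⊆ smoothClass D k L := by
  rintro _ ⟨f, rfl, hf, hf1, hfL⟩
  refine ⟨f, rfl, hf.contDiffOn, fun x _ => hf1 x, fun j hj x hx y hy => ?_⟩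
  have iteratedFDerivWithin_eq {z : EuclideanSpace ℝ (Fin d)} (hz : z ∈ D) :=
    iteratedFDerivWithin_eq_iteratedFDeriv hD (hf.of_le (mod_cast hj)).contDiffAt hz
  rw [iteratedFDerivWithin_eq hx, iteratedFDerivWithin_eq hy]
  exact hfL j hj x y

theorem mem_smoothClassBar_of_norm_iteratedFDeriv_succ_le (hf : ContDiff ℝ (k + 1 : ℕ) f)
    (hf1 : ∀ x, |f x| ≤ 1) (hfL : ∀ j ≤ k, ∀ x, ‖iteratedFDeriv ℝ (j + 1) f x‖ ≤ L j) :
    (fun x : D => f x) ∈ smoothClassBar D k L := by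
  refine ⟨f, rfl, hf.of_le (mod_cast k.le_succ), hf1, fun j hj x y => ?_⟩
  refine convex_univ.norm_image_sub_le_of_norm_fderiv_le (𝕜 := ℝ)
    (fun z _ => hf.differentiable_iteratedFDeriv (mod_cast Nat.lt_succ_of_le hj) z)
    (fun z _ => ?_) (Set.mem_univ y) (Set.mem_univ x)
  rw [norm_fderiv_iteratedFDeriv]
  exact hfL j hj z

theorem norm_iteratedFDeriv_succ_const_mul_const_sub {E : Type*} [NormedAddCommGroup E]
    [NormedSpace ℝ E] {u : E → ℝ} {j : ℕ} {x : E} (b c : ℝ) (hu : ContDiffAt ℝ (j + 1 : ℕ) u x) :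
    ‖iteratedFDeriv ℝ (j + 1) (fun y => b * (c - u y)) x‖ =
      |b| * ‖iteratedFDeriv ℝ (j + 1) u x‖ := by
  calc ‖iteratedFDeriv ℝ (j + 1) (fun y => b • (c - u y)) x‖
      = ‖b • (0 - iteratedFDeriv ℝ (j + 1) u x)‖ := by
        rw [iteratedFDeriv_const_smul_apply' (contDiffAt_const.sub hu),
          fun_iteratedFDeriv_sub_apply contDiffAt_const hu, iteratedFDeriv_succ_const,
          Pi.zero_apply]
    _ = |b| * ‖iteratedFDeriv ℝ (j + 1) u x‖ := by
        rw [zero_sub, smul_neg, norm_neg, norm_smul, Real.norm_eq_abs]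

theorem const_mul_one_sub_mem_smoothClassBar {b : ℝ} (hb : |b| ≤ 1)
    (hu : ContDiff ℝ (k + 1 : ℕ) u) (hu01 : ∀ x, u x ∈ Set.Icc 0 1)
    (huL : ∀ j ≤ k, ∀ x, |b| * ‖iteratedFDeriv ℝ (j + 1) u x‖ ≤ L j) :
    (fun x : D => b * (1 - u x)) ∈ smoothClassBar D k L := by
  refine mem_smoothClassBar_of_norm_iteratedFDeriv_succ_le
    (contDiff_const.mul (contDiff_const.sub hu)) (fun x => ?_) fun j hj x => ?_
  · have hx : |1 - u x| ≤ 1 := by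
      rw [abs_of_nonneg (sub_nonneg.2 (hu01 x).2)]
      exact sub_le_self 1 (hu01 x).1
    rw [abs_mul]
    exact mul_le_one₀ hb (abs_nonneg _) hx
  · rw [norm_iteratedFDeriv_succ_const_mul_const_sub _ _
      (hu.of_le (mod_cast Nat.succ_le_succ hj)).contDiffAt]
    exact huL j hj x

end SmoothClass

section FoolingFunction

theorem measureReal_sub_le_setIntegral_one_sub {α : Type*} [MeasurableSpace α] {μ : Measure α}
    {s U : Set α} (hs : μ s ≠ ∞) (hU : MeasurableSet U) (hUμ : μ U ≠ ∞) {u : α → ℝ}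
    (hu : AEStronglyMeasurable u (μ.restrict s))
    (hu01 : ∀ x, u x ∈ Set.Icc 0 1) (huU : ∀ x ∉ U, u x = 0) :
    μ.real s - μ.real U ≤ ∫ x in s, (1 - u x) ∂μ := by
  have : IsFiniteMeasure (μ.restrict s) := isFiniteMeasure_restrict.2 hs
  calc μ.real s - μ.real U ≤ μ.real (s \ U) := le_measureReal_sdiff hUμ
    _ = ∫ x in s, Uᶜ.indicator 1 x ∂μ := by
        rw [integral_indicator_one hU.compl, measureReal_restrict_apply hU.compl, Set.inter_comm,
          Set.sdiff_eq]
    _ ≤ ∫ x in s, (1 - u x) ∂μ := by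
        refine integral_mono ((integrable_const 1).indicator hU.compl) ?_ fun x => ?_
        · refine (integrable_const 1).sub (Integrable.of_bound hu 1 (ae_of_all _ fun x => ?_))
          rw [Real.norm_of_nonneg (hu01 x).1]
          exact (hu01 x).2
        · by_cases hx : x ∈ U
          · rw [Set.indicator_of_notMem (Set.notMem_compl_iff.2 hx)]
            exact sub_nonneg.2 (hu01 x).2
          · rw [Set.indicator_of_mem hx, huU x hx, sub_zero, Pi.one_apply]

theorem measureReal_iUnion_supSeminorm_closedBall_le {ι κ : Type*} [Fintype ι] [Fintype κ]
    (x : κ → EuclideanSpace ℝ ι) {r : ℝ} (hr : 0 ≤ r) :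
    volume.real (⋃ i, (supSeminorm ι).closedBall (x i) r) ≤
      Fintype.card κ * (2 * r) ^ Fintype.card ι := by
  refine (measureReal_iUnion_fintype_le _).trans_eq ?_
  have hcube (i : κ) :
      volume.real ((supSeminorm ι).closedBall (x i) r) = (2 * r) ^ Fintype.card ι := by
    rw [measureReal_def, volume_supSeminorm_closedBall _ hr, ENNReal.toReal_ofReal (by positivity)]
  simp only [hcube, Finset.sum_const, Finset.card_univ, nsmul_eq_mul]

theorem exists_mul_measureReal_sub_le_of_error_le (k : ℕ) :
    ∃ C : ℝ, 1 ≤ C ∧ ∀ {d n : ℕ} {D : Set (EuclideanSpace ℝ (Fin d))} {L : ℕ → ℝ}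
      {F : Set (D → ℝ)} {a ε : ℝ} (A : AdaptiveAlgorithm D n), MeasurableSet D → volume D ≠ ∞ →
      0 ≤ a → a ≤ 1 → (∀ j ≤ k, a * (C * d) ^ (j + 1) ≤ L j) → smoothClassBar D k L ⊆ F →
      0 ≤ ε → A.error F ≤ ENNReal.ofReal ε → a * (volume.real D - n * (1 / 4) ^ d) ≤ ε := by
  obtain ⟨C, hC, exists_cover⟩ :=
    exists_contDiff_eq_one_eq_zero_off_iUnion_closedBall k (r := 1 / 8) (by norm_num)
  refine ⟨C, hC, fun {d n D L F a ε} A hD hDfin ha0 ha1 haL hF hε hA => ?_⟩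
  let x (i : Fin n) : EuclideanSpace ℝ (Fin d) := A.node i (A.values 0 i)
  set U : Set (EuclideanSpace ℝ (Fin d)) := ⋃ i, (supSeminorm (Fin d)).closedBall (x i) (1 / 8)
  have hU : IsCompact U := isCompact_iUnion fun i => isCompact_supSeminorm_closedBall _ _
  have volume_U : volume.real U ≤ n * (1 / 4) ^ d := by
    refine (measureReal_iUnion_supSeminorm_closedBall_le x (by norm_num)).trans_eq ?_
    rw [Fintype.card_fin, Fintype.card_fin]
    norm_num
  obtain ⟨u, hu, hu01, hux, huU, hud⟩ := exists_cover x
  rw [Fintype.card_fin] at hud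
  have fooling_mem {b : ℝ} (hb : |b| = a) : (fun y : D => b * (1 - u y)) ∈ F :=
    hF <| const_mul_one_sub_mem_smoothClassBar (hb.trans_le ha1) (contDiff_infty.1 hu _) hu01
      fun j hj y => by
        rw [hb]
        exact (mul_le_mul_of_nonneg_left (hud _ (Nat.succ_le_succ hj) y) ha0).trans (haL j hj)
  have neg_fooling_mem : -(fun y : D => a * (1 - u y)) ∈ F := by
    have h := fooling_mem (b := -a) (by rw [abs_neg, abs_of_nonneg ha0])
    simp only [neg_mul] at h
    exact h
  calc a * (volume.real D - n * (1 / 4) ^ d)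
      ≤ a * ∫ y in D, (1 - u y) := by
        gcongr
        exact (sub_le_sub_left volume_U _).trans
          (measureReal_sub_le_setIntegral_one_sub hDfin hU.measurableSet hU.measure_ne_top
            hu.continuous.aestronglyMeasurable hu01 huU)
    _ = ∫ y : D, a * (1 - u y) ∂(volume.comap ((↑) : D → EuclideanSpace ℝ (Fin d))) := by
        rw [integral_subtype_comap hD fun y => a * (1 - u y), integral_const_mul]
    _ ≤ ε := A.integral_le_of_forall_node_eq_zero hε hA (fooling_mem (abs_of_nonneg ha0))
        neg_fooling_mem fun i hi => by rw [hux ⟨i, hi⟩, sub_self, mul_zero]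

theorem exists_two_pow_le_infoComplexity (k : ℕ) :
    ∃ C : ℝ, 1 ≤ C ∧ ∀ {d : ℕ} {D : Set (EuclideanSpace ℝ (Fin d))} {L : ℕ → ℝ}
      {F : Set (D → ℝ)} {a v : ℝ}, MeasurableSet D → volume D ≠ ∞ → v ≤ volume.real D →
      0 < a → a ≤ 1 → (∀ j ≤ k, a * (C * d) ^ (j + 1) ≤ L j) → smoothClassBar D k L ⊆ F →
      2 ≤ 2 ^ d * v → ((2 ^ d : ℕ) : ℕ∞) ≤ infoComplexity (a * (v / 2)) F := by
  obtain ⟨C, hC, mul_sub_le⟩ := exists_mul_measureReal_sub_le_of_error_le k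
  refine ⟨C, hC, fun {d D L F a v} hD hDfin hDv ha0 ha1 haL hF hdv =>
    le_iInf₂ fun n ⟨A, hA⟩ => ?_⟩
  have hv : 0 < v := pos_of_mul_pos_right (two_pos.trans_le hdv) (by positivity)
  have error_bound := le_of_mul_le_mul_left
    (mul_sub_le A hD hDfin ha0.le ha1 haL hF (by positivity) hA) ha0
  have four_pow_mul_le : (4 : ℝ) ^ d * v ≤ 2 * n := by
    have half_le : v / 2 ≤ n / 4 ^ d := by
      rw [one_div_pow, mul_one_div] at error_bound
      linarith
    rw [le_div_iff₀ (by positivity)] at half_le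
    linarith
  have two_pow_le : (2 : ℝ) ^ d ≤ n := by
    have : (4 : ℝ) ^ d = 2 ^ d * 2 ^ d := by rw [← mul_pow]; norm_num
    nlinarith [pow_pos (two_pos (α := ℝ)) d]
  exact_mod_cast two_pow_le

end FoolingFunction

section Tractability

theorem coe_log_natCast_le_log_max_one {N : ℕ} {M : ℕ∞} (h : (N : ℕ∞) ≤ M) :
    (Real.log N : EReal) ≤ ENNReal.log (max 1 (M : ℝ≥0∞)) := by
  rcases N.eq_zero_or_pos with rfl | hN
  · rw [Nat.cast_zero, Real.log_zero, EReal.coe_zero, ← ENNReal.log_one]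
    exact ENNReal.log_monotone (le_max_left _ _)
  · rw [← ENNReal.log_ofReal_of_pos (by exact_mod_cast hN), ENNReal.ofReal_natCast]
    exact ENNReal.log_monotone (le_max_of_le_right (by exact_mod_cast ENat.toENNReal_le.2 h))

variable {D : (d : ℕ) → Set (EuclideanSpace ℝ (Fin d))} {F : (d : ℕ) → Set (D d → ℝ)}

theorem UniformlyWeaklyTractable.eventually_log_lt (hF : UniformlyWeaklyTractable F) {α : ℝ}
    (hα0 : 0 < α) (hα1 : α < 1) {ε : ℕ → ℝ} (hε : ∀ᶠ d in atTop, ε d ∈ Set.Ioo 0 1) {δ : ℝ}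
    (hδ : 0 < δ) :
    ∀ᶠ d : ℕ in atTop, ∀ N : ℕ, (N : ℕ∞) ≤ infoComplexity (ε d) (F d) →
      Real.log N < δ * ((d : ℝ) ^ α + ε d ^ (-α)) := by
  have tendsto_pair : Tendsto (fun d : ℕ => (d, ε d)) atTop
      (comap (fun p : ℕ × ℝ => (p.1 : ℝ) + p.2⁻¹) atTop ⊓
        𝓟 {p : ℕ × ℝ | 1 ≤ p.1 ∧ 0 < p.2 ∧ p.2 < 1}) := by
    refine tendsto_inf.2 ⟨tendsto_comap_iff.2 ?_, tendsto_principal.2 ?_⟩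
    · refine tendsto_atTop_mono' _ ?_ tendsto_natCast_atTop_atTop
      filter_upwards [hε] with d hd
      exact le_add_of_nonneg_right (inv_nonneg.2 hd.1.le)
    · filter_upwards [hε, eventually_ge_atTop 1] with d hd hd1 using ⟨hd1, hd⟩
  filter_upwards [((hF α hα0 hα1).comp tendsto_pair).eventually_lt_const (EReal.coe_pos.2 hδ), hε]
    with d hlt hd N hN
  have hpos : 0 < (d : ℝ) ^ α + ε d ^ (-α) :=
    add_pos_of_nonneg_of_pos (by positivity) (Real.rpow_pos_of_pos hd.1 _)
  rw [Function.comp_apply, EReal.div_lt_iff (EReal.coe_pos.2 hpos) (EReal.coe_ne_top _),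
    ← EReal.coe_mul] at hlt
  exact EReal.coe_lt_coe_iff.1 ((coe_log_natCast_le_log_max_one hN).trans_lt hlt)

theorem rpow_add_rpow_neg_le {c s x α : ℝ} (hc : 0 < c) (hx : 1 ≤ x) (hα : α ≤ 1)
    (hsα : s * α ≤ 1) : x ^ α + (c * x ^ (-s)) ^ (-α) ≤ (1 + c ^ (-α)) * x := by
  have hx0 : 0 ≤ x := zero_le_one.trans hx
  have rpow_le_self {β : ℝ} (hβ : β ≤ 1) : x ^ β ≤ x :=
    (Real.rpow_le_rpow_of_exponent_le hx hβ).trans_eq (Real.rpow_one x)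
  calc x ^ α + (c * x ^ (-s)) ^ (-α) = x ^ α + c ^ (-α) * x ^ (s * α) := by
        rw [Real.mul_rpow hc.le (by positivity), ← Real.rpow_mul hx0, neg_mul_neg]
    _ ≤ x + c ^ (-α) * x := by
        gcongr
        · exact rpow_le_self hα
        · exact rpow_le_self hsα
    _ = (1 + c ^ (-α)) * x := by ring

theorem eventually_mul_natCast_rpow_neg_lt_one (c : ℝ) {s : ℝ} (hs : 0 < s) :
    ∀ᶠ d : ℕ in atTop, c * (d : ℝ) ^ (-s) < 1 := by
  have h := ((tendsto_rpow_neg_atTop hs).comp tendsto_natCast_atTop_atTop).const_mul c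
  rw [mul_zero] at h
  exact h.eventually_lt_const one_pos

theorem not_uniformlyWeaklyTractable_of_frequently {c s : ℝ} (hc : 0 < c) (hs : 0 < s)
    (hF : ∃ᶠ d : ℕ in atTop,
      ((2 ^ d : ℕ) : ℕ∞) ≤ infoComplexity (c * (d : ℝ) ^ (-s)) (F d)) :
    ¬ UniformlyWeaklyTractable F := by
  intro hT
  set α : ℝ := 1 / (s + 1)
  have hα0 : 0 < α := by positivity
  have hα1 : α < 1 := (div_lt_one (by positivity)).2 (by linarith)
  have hsα : s * α ≤ 1 := by
    rw [mul_one_div]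
    exact (div_le_one (by positivity)).2 (by linarith)
  have ε_mem : ∀ᶠ d : ℕ in atTop, c * (d : ℝ) ^ (-s) ∈ Set.Ioo 0 1 := by
    filter_upwards [eventually_mul_natCast_rpow_neg_lt_one c hs, eventually_gt_atTop 0]
      with d hd hd0
    have : (0 : ℝ) < d := Nat.cast_pos.2 hd0
    exact ⟨by positivity, hd⟩
  set K : ℝ := 1 + c ^ (-α)
  have hK : 0 < K := by positivity
  have hlog : 0 < Real.log 2 / K := div_pos (Real.log_pos one_lt_two) hK
  obtain ⟨d, hd, hlt, hd1⟩ := (hF.and_eventually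
    ((hT.eventually_log_lt hα0 hα1 ε_mem hlog).and (eventually_ge_atTop 1))).exists
  refine lt_irrefl (d * Real.log 2) ?_
  calc (d : ℝ) * Real.log 2 = Real.log ((2 ^ d : ℕ) : ℝ) := by push_cast; rw [Real.log_pow]
    _ < Real.log 2 / K * ((d : ℝ) ^ α + (c * (d : ℝ) ^ (-s)) ^ (-α)) := hlt _ hd
    _ ≤ Real.log 2 / K * (K * d) := by
        gcongr
        exact rpow_add_rpow_neg_le hc (mod_cast hd1) hα1.le hsα
    _ = d * Real.log 2 := by field_simp

theorem exists_frequently_mul_rpow_neg_le {k : ℕ} {L : ℕ → ℕ → ℝ} {m : ℝ}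
    (hL : 0 < limsup (fun d : ℕ => ⨅ j : Fin (k + 1), ((L j d * (d : ℝ) ^ m : ℝ) : EReal)) atTop) :
    ∃ c : ℝ, 0 < c ∧ ∃ᶠ d : ℕ in atTop, ∀ j ≤ k, c * (d : ℝ) ^ (-m) ≤ L j d := by
  obtain ⟨c, hc0, hc⟩ := EReal.lt_iff_exists_real_btwn.1 hL
  refine ⟨c, EReal.coe_pos.1 hc0, ?_⟩
  refine ((frequently_lt_of_lt_limsup (by isBoundedDefault) hc).and_eventually
    (eventually_gt_atTop 0)).mono fun d ⟨hd, hd0⟩ j hj => ?_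
  have hdm : 0 < (d : ℝ) ^ m := Real.rpow_pos_of_pos (Nat.cast_pos.2 hd0) m
  have hjd : c < L j d * (d : ℝ) ^ m :=
    EReal.coe_lt_coe_iff.1 (hd.trans_le (iInf_le _ (⟨j, Nat.lt_succ_of_le hj⟩ : Fin (k + 1))))
  rw [Real.rpow_neg d.cast_nonneg, ← div_eq_mul_inv]
  exact (div_le_iff₀ hdm).2 hjd.le

theorem div_pow_mul_rpow_neg_mul_pow_le {c C x m : ℝ} {i n : ℕ} (hc : 0 ≤ c) (hC : 1 ≤ C)
    (hx : 1 ≤ x) (hi : i ≤ n) :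
    c / C ^ n * x ^ (-(max m 0 + n)) * (C * x) ^ i ≤ c * x ^ (-m) := by
  have : 0 < C := one_pos.trans_le hC
  have hx0 : 0 < x := one_pos.trans_le hx
  calc c / C ^ n * x ^ (-(max m 0 + n)) * (C * x) ^ i
      ≤ c / C ^ n * x ^ (-(max m 0 + n)) * (C * x) ^ n := by
        gcongr
        exact one_le_mul_of_one_le_of_one_le hC hx
    _ = c * x ^ (-max m 0) := by
        rw [neg_add, Real.rpow_add hx0, Real.rpow_neg hx0.le (n : ℝ), Real.rpow_natCast, mul_pow]
        field_simp
    _ ≤ c * x ^ (-m) := by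
        gcongr
        exact le_max_left m 0

theorem exists_frequently_two_pow_le_infoComplexity
    (hDmeas : ∀ d, 1 ≤ d → MeasurableSet (D d)) {v : ℝ} (hv : 0 < v)
    (hDvol : ∀ d, 1 ≤ d → v ≤ volume.real (D d)) {k : ℕ} {L : ℕ → ℕ → ℝ} {c m : ℝ} (hc : 0 < c)
    (hL : ∃ᶠ d : ℕ in atTop, ∀ j ≤ k, c * (d : ℝ) ^ (-m) ≤ L j d)
    (hF : ∀ d, 1 ≤ d → smoothClassBar (D d) k (fun j => L j d) ⊆ F d) :
    ∃ b s : ℝ, 0 < b ∧ 0 < s ∧ ∃ᶠ d : ℕ in atTop,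
      ((2 ^ d : ℕ) : ℕ∞) ≤ infoComplexity (b * (d : ℝ) ^ (-s)) (F d) := by
  obtain ⟨C, hC, two_pow_le⟩ := exists_two_pow_le_infoComplexity k
  set s : ℝ := max m 0 + (k + 1 : ℕ)
  set a : ℝ := c / C ^ (k + 1)
  have hs : 0 < s := add_pos_of_nonneg_of_pos (le_max_right m 0) (by positivity)
  refine ⟨a * (v / 2), s, by positivity, hs, ?_⟩
  have eventually_two_le : ∀ᶠ d : ℕ in atTop, 2 ≤ 2 ^ d * v :=
    ((tendsto_pow_atTop_atTop_of_one_lt one_lt_two).atTop_mul_const hv).eventually_ge_atTop 2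
  refine (hL.and_eventually (((eventually_mul_natCast_rpow_neg_lt_one a hs).and
    eventually_two_le).and (eventually_ge_atTop 1))).mono fun d ⟨hLd, ⟨had, hdv⟩, hd⟩ => ?_
  have hd1 : (1 : ℝ) ≤ d := mod_cast hd
  have hDfin : volume (D d) ≠ ∞ := fun h => by
    have := hDvol d hd
    rw [measureReal_def, h, ENNReal.toReal_top] at this
    exact hv.not_ge this
  rw [mul_right_comm]
  exact two_pow_le (hDmeas d hd) hDfin (hDvol d hd) (by positivity) had.le (fun j hj =>
    (div_pow_mul_rpow_neg_mul_pow_le hc.le hC hd1 (Nat.succ_le_succ hj)).trans (hLd j hj))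
    (hF d hd) hdv

end Tractability

theorem mainTheorem12_general {D : (d : ℕ) → Set (EuclideanSpace ℝ (Fin d))}
    (hDmeas : ∀ d, 1 ≤ d → MeasurableSet (D d)) {v : ℝ} (hv : 0 < v)
    (hDvol : ∀ d, 1 ≤ d → v ≤ volume.real (D d)) {k : ℕ} {L : ℕ → ℕ → ℝ} {m : ℝ}
    (hL : 0 < limsup (fun d : ℕ => ⨅ j : Fin (k + 1), ((L j d * (d : ℝ) ^ m : ℝ) : EReal)) atTop)
    {F : (d : ℕ) → Set (D d → ℝ)}
    (hF : ∀ d, 1 ≤ d → smoothClassBar (D d) k (fun j => L j d) ⊆ F d) :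
    ¬ UniformlyWeaklyTractable F := by
  obtain ⟨c, hc, hLc⟩ := exists_frequently_mul_rpow_neg_le hL
  obtain ⟨b, s, hb, hs, two_pow_le⟩ :=
    exists_frequently_two_pow_le_infoComplexity hDmeas hv hDvol hc hLc hF
  exact not_uniformlyWeaklyTractable_of_frequently hb hs two_pow_le

theorem mainTheorem12
    (D : (d : ℕ) → Set (EuclideanSpace ℝ (Fin d)))
    (hDopen : ∀ d, 1 ≤ d → IsOpen (D d))
    (hDvol : ∀ d, 1 ≤ d → volume (D d) = 1)
    (k : ℕ) (L : ℕ → ℕ → ℝ)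
    (hLpos : ∀ j ≤ k, ∀ d, 1 ≤ d → 0 < L j d)
    (m : ℝ)
    (hL : 0 < limsup (fun d : ℕ => ⨅ j : Fin (k + 1), ((L j d * (d : ℝ) ^ m : ℝ) : EReal)) atTop) :
    ¬ UniformlyWeaklyTractable (fun d => smoothClassBar (D d) k (fun j => L j d)) ∧
    ¬ UniformlyWeaklyTractable (fun d => smoothClass (D d) k (fun j => L j d)) := by
  have hDvol' (d : ℕ) (hd : 1 ≤ d) : 1 ≤ volume.real (D d) := by
    rw [measureReal_def, hDvol d hd, ENNReal.toReal_one]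
  have general (F : (d : ℕ) → Set (D d → ℝ)) :=
    mainTheorem12_general (fun d hd => (hDopen d hd).measurableSet) one_pos hDvol' hL (F := F)
  exact ⟨general _ fun d _ => subset_rfl, general _ fun d hd =>
    smoothClassBar_subset_smoothClass (hDopen d hd).uniqueDiffOn k fun j => L j d⟩
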